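/- Let $\mathcal X,\mathcal Y,\mathcal Z$ be finite alphabets, let $P_{YZ|X}$ be a discrete memoryless wiretap channel with marginal channels $P_{Y|X}$ (to the legitimate receiver) and $P_{Z|X}$ (to the eavesdropper), and let $P_Z$ be a distribution on $\mathcal Z$ that is induced through $P_{Z|X}$ by at least one input distribution. For $n\in\mathbb N$ and rates $R_0,R_1\ge 0$, let $M_0,M_1$ be independent and uniformly distributed over $\mathcal M_0=\{1,\dots,\lfloor e^{nR_0}\rfloor\}$ and $\mathcal M_1=\{1,\dots,\lfloor e^{nR_1}\rfloor\}$. An $(n,R_0,R_1)$ secrecy code consists of a stochastic encoder $P_{X^n|M_0M_1}$ and a stochastic decoder $P_{\widehat M_0\widehat M_1|Y^n}$ with values in $\mathcal M_0\times\mathcal M_1$; the sequence $X^n$ is sent over $n$ uses of the memoryless channel $P_{YZ|X}$, with outputs $Y^n$ and $Z^n$. The pair $(R_0,R_1)$ is $P_Z$-achievable if there is a sequence of $(n,R_0,R_1)$ secrecy codes with $$\lim_{n\to\infty}\mathbb P\{(M_0,M_1)\ne(\widehat M_0,\widehat M_1)\}=0\qquad\text{and}\qquad P_{M_1Z^n}=P_{M_1}P_Z^{n}\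 \text{ for every } n,$$ where $P_Z^n$ is the $n$-fold product of $P_Z$. Let $\mathcal R(P_Z)$ be the closure of the set of $P_Z$-achievable pairs. The perfect stealth-secrecy capacity is $$C_1(P_Z):=\max_{(R_0,R_1)\in\mathcal R(P_Z)}R_1 .$$ The channel $P_{YZ|X}$ is called $P_Z$-redundant if there are two input distributions $Q_X,Q_X'$ that both induce $P_Z$ through $P_{Z|X}$ but induce two different distributions of $Y$ through $P_{Y|X}$. **Theorem.** The maximum that defines $C_1(P_Z)$ exists, and $C_1(P_Z)>0$ if and only if the channel $P_{YZ|X}$ is $P_Z$-redundant. -/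

import Mathlib

open scoped NNReal ENNReal Topology

noncomputable section

namespace Wiretap

/-- The product distribution `∏ i, p i` on sequences of length `n` over a finite alphabet. -/
def productPMF {α : Type*} [Fintype α] {n : ℕ} (p : Fin n → PMF α) : PMF (Fin n → α) :=
  PMF.ofFintype (fun a => ∏ i, p i (a i)) (by
    classical
    have h : ∀ i, ∑ a, p i a = 1 := fun i => by
      rw [← tsum_fintype (L := .unconditional _)]
      exact (p i).tsum_coe
    rw [← Fintype.prod_sum]
    simp [h])

variable {X Y Z : Type*} [Fintype X] [Fintype Y] [Fintype Z]

/-- The channel `P_{Y|X}` to the legitimate receiver, a marginal of the wiretap channel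
`P_{YZ|X}`. -/
def legitimateChannel (W : X → PMF (Y × Z)) (x : X) : PMF Y := (W x).map Prod.fst

/-- The channel `P_{Z|X}` to the eavesdropper, a marginal of the wiretap channel `P_{YZ|X}`. -/
def eavesdropperChannel (W : X → PMF (Y × Z)) (x : X) : PMF Z := (W x).map Prod.snd

/-- The set of the input distributions `Q` that induce the output distribution `P` through the
channel `V`, that is, `P(b) = ∑ a, Q(a) V(b | a)`. -/
def inputsInducing {A B : Type*} (V : A → PMF B) (P : PMF B) : Set (PMF A) :=
  {Q | Q.bind V = P}

/-- The wiretap channel is `P_Z`-redundant: two input distributions induce the same `P_Z` at the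
eavesdropper and different output distributions at the legitimate receiver. -/
def IsRedundant (W : X → PMF (Y × Z)) (PZ : PMF Z) : Prop :=
  ∃ Q ∈ inputsInducing (eavesdropperChannel W) PZ,
    ∃ Q' ∈ inputsInducing (eavesdropperChannel W) PZ,
      Q.bind (legitimateChannel W) ≠ Q'.bind (legitimateChannel W)

/-- The message set `[1 : e^{nR}]`, with `⌊e^{nR}⌋` elements. -/
abbrev Message (n : ℕ) (R : ℝ≥0) : Type := Fin ⌊Real.exp (n * R)⌋₊

instance (n : ℕ) (R : ℝ≥0) : Nonempty (Message n R) :=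
  Fin.pos_iff_nonempty.mp (Nat.floor_pos.mpr (Real.one_le_exp (by positivity)))

/-- An `(n, R₀, R₁)` secrecy code: a stochastic encoder and a stochastic decoder. -/
structure SecrecyCode (X Y : Type*) (n : ℕ) (R₀ R₁ : ℝ≥0) where
  encoder : Message n R₀ × Message n R₁ → PMF (Fin n → X)
  decoder : (Fin n → Y) → PMF (Message n R₀ × Message n R₁)

/-- The joint law of `((M₀, M₁), Zⁿ, (M̂₀, M̂₁))` that a code induces: the messages are independent
and uniform, the wiretap channel is used `n` times without memory, and the decoder sees `Yⁿ`. -/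
def SecrecyCode.law {n : ℕ} {R₀ R₁ : ℝ≥0} (c : SecrecyCode X Y n R₀ R₁) (W : X → PMF (Y × Z)) :
    PMF ((Message n R₀ × Message n R₁) × (Fin n → Z) × (Message n R₀ × Message n R₁)) :=
  (PMF.uniformOfFintype (Message n R₀ × Message n R₁)).bind fun m =>
    (c.encoder m).bind fun x =>
      (productPMF fun i => W (x i)).bind fun yz =>
        (c.decoder fun i => (yz i).1).map fun m' => (m, (fun i => (yz i).2), m')

/-- The probability `ℙ{(M₀, M₁) ≠ (M̂₀, M̂₁)}`. -/
def SecrecyCode.errorProb {n : ℕ} {R₀ R₁ : ℝ≥0} (c : SecrecyCode X Y n R₀ R₁)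
    (W : X → PMF (Y × Z)) : ℝ≥0∞ :=
  (c.law W).toOuterMeasure {ω | ω.1 ≠ ω.2.2}

/-- The secrecy constraint `P_{M₁ Zⁿ} = P_{M₁} P_Zⁿ`. -/
def SecrecyCode.IsPerfect {n : ℕ} {R₀ R₁ : ℝ≥0} (c : SecrecyCode X Y n R₀ R₁)
    (W : X → PMF (Y × Z)) (PZ : PMF Z) : Prop :=
  ∀ (m₁ : Message n R₁) (z : Fin n → Z),
    (c.law W).map (fun ω => (ω.1.2, ω.2.1)) (m₁, z) =
      (c.law W).map (fun ω => ω.1.2) m₁ * productPMF (fun _ => PZ) z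

/-- The rate pair `R = (R₀, R₁)` is `P_Z`-achievable. -/
def IsAchievable (W : X → PMF (Y × Z)) (PZ : PMF Z) (R : ℝ≥0 × ℝ≥0) : Prop :=
  ∃ c : ∀ n : ℕ, SecrecyCode X Y n R.1 R.2,
    Filter.Tendsto (fun n => (c n).errorProb W) Filter.atTop (𝓝 0) ∧
      ∀ n, (c n).IsPerfect W PZ

/-- The `P_Z`-admissible region. -/
def admissibleRegion (W : X → PMF (Y × Z)) (PZ : PMF Z) : Set (ℝ≥0 × ℝ≥0) :=
  closure {R | IsAchievable W PZ R}

/-- The rates `R₁` of the pairs `(R₀, R₁)` in the `P_Z`-admissible region. -/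
def admissibleSecrecyRates (W : X → PMF (Y × Z)) (PZ : PMF Z) : Set ℝ≥0 :=
  Prod.snd '' admissibleRegion W PZ

/-- The perfect stealth-secrecy capacity `C₁(P_Z)`, the largest admissible rate `R₁`. -/
def stealthSecrecyCapacity (W : X → PMF (Y × Z)) (PZ : PMF Z) : ℝ≥0 :=
  sSup (admissibleSecrecyRates W PZ)

end Wiretap

end

/-! Secrecy depends only on `P_{Z|X}` and reliability only on `P_{Y|X}`.

If the channel is redundant, let each bit of a binary codeword choose between `Q` and `Q'` for its
letter. The eavesdropper sees `P_Z^n` whatever the codeword, so secrecy is free. The legitimate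
receiver faces a binary-input channel with distinct rows, whose Bhattacharyya coefficient is `β <
1`; random coding gives error at most `|M| ((1 + β) / 2) ^ n`, which vanishes at small positive
rates (`exists_secrecyCode`).

If it is not redundant, take an input `Q` of maximal support inducing `P_Z`. A signed perturbation
of `Q` invisible through `P_{Z|X}` must be invisible through `P_{Y|X}`. By duality `P_{Y|X}` is, on
that support, a linear image of `P_{Z|X}` under a possibly signed kernel
(`exists_linear_degradation`). This tensorizes: the law `P_Z^n` determines the law of `Y^n`. Perfect
secrecy thus makes `Y^n` independent of `M₁`, and correct decoding has probability at most `1 /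
|M₁|`.

The maximum exists because achievable rates are bounded by `log |Y|`, so the closed region is
compact. -/

noncomputable section

set_option linter.unusedSectionVars false

namespace Wiretap

/-! ### Distributions on finite alphabets and memoryless channels -/

section PMF

variable {α β : Type*}

lemma sum_coe_eq_one [Fintype α] (p : PMF α) : ∑ a, p a = 1 := by
  rw [← tsum_fintype (L := .unconditional _)]
  exact p.tsum_coe

lemma sum_toReal_eq_one [Fintype α] (p : PMF α) : ∑ a, (p a).toReal = 1 := by
  rw [← ENNReal.toReal_sum fun a _ => p.apply_ne_top a, sum_coe_eq_one, ENNReal.toReal_one]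

lemma bind_apply_eq_sum [Fintype α] (p : PMF α) (f : α → PMF β) (b : β) :
    p.bind f b = ∑ a, p a * f a b := by
  rw [PMF.bind_apply, tsum_fintype]

lemma toReal_bind_apply [Fintype α] (p : PMF α) (f : α → PMF β) (b : β) :
    (p.bind f b).toReal = ∑ a, (p a).toReal * (f a b).toReal := by
  rw [bind_apply_eq_sum, ENNReal.toReal_sum]
  · simp
  · exact fun a _ => ENNReal.mul_ne_top (p.apply_ne_top a) ((f a).apply_ne_top b)

lemma pmf_ext_toReal {p q : PMF α} (h : ∀ a, (p a).toReal = (q a).toReal) : p = q :=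
  PMF.ext fun a => (ENNReal.toReal_eq_toReal_iff' (p.apply_ne_top a) (q.apply_ne_top a)).1 (h a)

lemma map_apply_eq_sum [Fintype α] [DecidableEq β] (p : PMF α) (f : α → β) (b : β) :
    p.map f b = ∑ a, if f a = b then p a else 0 := by
  rw [PMF.map_apply, tsum_fintype]
  refine Finset.sum_congr rfl fun a _ => ?_
  by_cases h : f a = b
  · simp [h]
  · simp [h, Ne.symm h]

lemma toOuterMeasure_compl_singleton_add (p : PMF α) (a : α) :
    p.toOuterMeasure {b | a ≠ b} + p a = 1 := by
  classical
  rw [← p.toOuterMeasure_apply_singleton a, PMF.toOuterMeasure_apply, PMF.toOuterMeasure_apply,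
    ← ENNReal.tsum_add, ← p.tsum_coe]
  refine tsum_congr fun b => ?_
  by_cases h : b = a
  · simp [h]
  · simp [h, Ne.symm h]

@[simp]
lemma productPMF_apply [Fintype α] {n : ℕ} (p : Fin n → PMF α) (a : Fin n → α) :
    productPMF p a = ∏ i, p i (a i) := rfl

lemma productPMF_map [Fintype α] [Fintype β] {n : ℕ} (p : Fin n → PMF α) (f : α → β) :
    (productPMF p).map (fun a i => f (a i)) = productPMF fun i => (p i).map f := by
  classical
  ext b
  simp only [map_apply_eq_sum, productPMF_apply, Fintype.prod_sum, funext_iff]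
  refine Finset.sum_congr rfl fun a _ => ?_
  by_cases h : ∀ i, f (a i) = b i
  · simp [h]
  · obtain ⟨i, hi⟩ := not_forall.1 h
    rw [if_neg h, Finset.prod_eq_zero (Finset.mem_univ i) (if_neg hi)]

lemma productPMF_map_eval [Fintype α] {n : ℕ} (p : Fin n → PMF α) (i : Fin n) :
    (productPMF p).map (fun a => a i) = p i := by
  classical
  ext b
  have key : ∀ a : Fin n → α, (if a i = b then productPMF p a else 0) =
      ∏ j, if j = i → a j = b then p j (a j) else 0 := by
    intro a
    by_cases h : a i = b
    · rw [if_pos h, productPMF_apply]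
      refine Finset.prod_congr rfl fun j _ => (if_pos ?_).symm
      rintro rfl
      exact h
    · rw [if_neg h, Finset.prod_eq_zero (Finset.mem_univ i)]
      simp [h]
  rw [map_apply_eq_sum, Finset.sum_congr rfl fun a _ => key a,
    ← Fintype.prod_sum (f := fun j c => if j = i → c = b then p j c else 0),
    Finset.prod_eq_single i]
  · simp
  · intro j _ hj
    simp [hj, sum_coe_eq_one]
  · simp

/-- The law of the output of `n` memoryless uses of a channel with input `x`. -/
def memoryless [Fintype β] (V : α → PMF β) {n : ℕ} (x : Fin n → α) : PMF (Fin n → β) :=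
  productPMF fun i => V (x i)

@[simp]
lemma memoryless_apply [Fintype β] (V : α → PMF β) {n : ℕ} (x : Fin n → α) (b : Fin n → β) :
    memoryless V x b = ∏ i, V (x i) (b i) := rfl

lemma productPMF_bind_memoryless [Fintype α] [Fintype β] {n : ℕ} (q : Fin n → PMF α)
    (V : α → PMF β) :
    (productPMF q).bind (memoryless V) = productPMF fun i => (q i).bind V := by
  ext b
  simp only [bind_apply_eq_sum, productPMF_apply, memoryless_apply, Fintype.prod_sum,
    Finset.prod_mul_distrib]

end PMF

/-! ### Error probability and secrecy of a code -/

variable {X Y Z : Type*} [Fintype X] [Fintype Y] [Fintype Z] {n : ℕ} {R₀ R₁ : ℝ≥0}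

namespace SecrecyCode

/-- The law of the observation of the legitimate receiver given the messages. -/
def legitimateOutput (c : SecrecyCode X Y n R₀ R₁) (W : X → PMF (Y × Z))
    (m : Message n R₀ × Message n R₁) : PMF (Fin n → Y) :=
  (c.encoder m).bind (memoryless (legitimateChannel W))

/-- The law of the observation of the eavesdropper given the messages. -/
def eavesdropperOutput (c : SecrecyCode X Y n R₀ R₁) (W : X → PMF (Y × Z))
    (m : Message n R₀ × Message n R₁) : PMF (Fin n → Z) :=
  (c.encoder m).bind (memoryless (eavesdropperChannel W))

lemma law_map_messages (c : SecrecyCode X Y n R₀ R₁) (W : X → PMF (Y × Z)) :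
    (c.law W).map (fun ω => (ω.1, ω.2.2)) =
      (PMF.uniformOfFintype (Message n R₀ × Message n R₁)).bind fun m =>
        (c.legitimateOutput W m).bind fun y => (c.decoder y).map (Prod.mk m) := by
  simp only [law, legitimateOutput, PMF.map_bind, PMF.bind_bind, PMF.map_comp]
  refine congrArg _ (funext fun m => congrArg _ (funext fun x => ?_))
  have h : memoryless (legitimateChannel W) x =
      (productPMF fun i => W (x i)).map fun yz i => (yz i).1 :=
    (productPMF_map _ Prod.fst).symm
  rw [h, PMF.bind_map]
  rfl

lemma law_map_eavesdropper (c : SecrecyCode X Y n R₀ R₁) (W : X → PMF (Y × Z)) :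
    (c.law W).map (fun ω => (ω.1, ω.2.1)) =
      (PMF.uniformOfFintype (Message n R₀ × Message n R₁)).bind fun m =>
        (c.eavesdropperOutput W m).map (Prod.mk m) := by
  simp only [law, eavesdropperOutput, PMF.map_bind, PMF.map_comp]
  refine congrArg _ (funext fun m => congrArg _ (funext fun x => ?_))
  have h : memoryless (eavesdropperChannel W) x =
      (productPMF fun i => W (x i)).map fun yz i => (yz i).2 :=
    (productPMF_map _ Prod.snd).symm
  rw [h, PMF.map_comp, ← PMF.bind_pure_comp]
  refine congrArg _ (funext fun yz => ?_)
  exact PMF.map_const (c.decoder fun i => (yz i).1) (m, fun i => (yz i).2)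

lemma errorProb_eq (c : SecrecyCode X Y n R₀ R₁) (W : X → PMF (Y × Z)) :
    c.errorProb W = ∑ m, (Fintype.card (Message n R₀ × Message n R₁) : ℝ≥0∞)⁻¹ *
      ∑ y, c.legitimateOutput W m y * (c.decoder y).toOuterMeasure {m' | m ≠ m'} := by
  have h : c.errorProb W = ((c.law W).map (fun ω => (ω.1, ω.2.2))).toOuterMeasure
      {p | p.1 ≠ p.2} := by
    rw [PMF.toOuterMeasure_map_apply]
    rfl
  rw [h, law_map_messages, PMF.toOuterMeasure_bind_apply, tsum_fintype]
  refine Finset.sum_congr rfl fun m _ => ?_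
  rw [PMF.toOuterMeasure_bind_apply, tsum_fintype, PMF.uniformOfFintype_apply]
  simp only [PMF.toOuterMeasure_map_apply]
  rfl

/-- The probability that the messages are decoded correctly. -/
def successProb (c : SecrecyCode X Y n R₀ R₁) (W : X → PMF (Y × Z)) : ℝ≥0∞ :=
  ∑ m, (Fintype.card (Message n R₀ × Message n R₁) : ℝ≥0∞)⁻¹ *
    ∑ y, c.legitimateOutput W m y * c.decoder y m

lemma errorProb_add_successProb (c : SecrecyCode X Y n R₀ R₁) (W : X → PMF (Y × Z)) :
    c.errorProb W + c.successProb W = 1 := by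
  rw [errorProb_eq, successProb, ← Finset.sum_add_distrib]
  simp only [← mul_add, ← Finset.sum_add_distrib, toOuterMeasure_compl_singleton_add, mul_one,
    sum_coe_eq_one]
  rw [Finset.sum_const, Finset.card_univ, nsmul_eq_mul]
  exact ENNReal.mul_inv_cancel (by simp [Fintype.card_ne_zero, -Fintype.card_prod])
    (ENNReal.natCast_ne_top _)

lemma law_map_secret_eavesdropper (c : SecrecyCode X Y n R₀ R₁) (W : X → PMF (Y × Z))
    (m₁ : Message n R₁) (z : Fin n → Z) :
    (c.law W).map (fun ω => (ω.1.2, ω.2.1)) (m₁, z) =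
      ∑ m₀, (Fintype.card (Message n R₀ × Message n R₁) : ℝ≥0∞)⁻¹ *
        c.eavesdropperOutput W (m₀, m₁) z := by
  classical
  have h : (c.law W).map (fun ω => (ω.1.2, ω.2.1)) =
      ((c.law W).map (fun ω => (ω.1, ω.2.1))).map fun p => (p.1.2, p.2) := by
    rw [PMF.map_comp]
    rfl
  rw [h, law_map_eavesdropper, PMF.map_bind, bind_apply_eq_sum, Fintype.sum_prod_type]
  refine Finset.sum_congr rfl fun m₀ _ => ?_
  rw [Finset.sum_eq_single m₁]
  · rw [PMF.uniformOfFintype_apply, PMF.map_comp, map_apply_eq_sum]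
    simp
  · intro m _ hm
    rw [PMF.map_comp, map_apply_eq_sum]
    simp [hm]
  · simp

lemma law_map_secret (c : SecrecyCode X Y n R₀ R₁) (W : X → PMF (Y × Z)) (m₁ : Message n R₁) :
    (c.law W).map (fun ω => ω.1.2) m₁ = (Fintype.card (Message n R₁) : ℝ≥0∞)⁻¹ := by
  classical
  have h : (c.law W).map (fun ω => ω.1.2) =
      (PMF.uniformOfFintype (Message n R₀ × Message n R₁)).map Prod.snd := by
    have h' : (c.law W).map (fun ω => ω.1.2) =
        ((c.law W).map (fun ω => (ω.1, ω.2.1))).map fun p => p.1.2 := by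
      rw [PMF.map_comp]
      rfl
    rw [h', law_map_eavesdropper, PMF.map_bind, ← PMF.bind_pure_comp]
    refine congrArg _ (funext fun m => ?_)
    rw [PMF.map_comp]
    exact PMF.map_const (c.eavesdropperOutput W m) m.2
  rw [h, map_apply_eq_sum, Fintype.sum_prod_type]
  simp only [PMF.uniformOfFintype_apply, Finset.sum_ite_eq', Finset.mem_univ, if_true,
    Finset.sum_const, Finset.card_univ, nsmul_eq_mul, Fintype.card_prod, Nat.cast_mul]
  rw [ENNReal.mul_inv (by simp) (by simp), ← mul_assoc, ENNReal.mul_inv_cancel, one_mul]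
  · exact_mod_cast Fintype.card_ne_zero
  · exact ENNReal.natCast_ne_top _

/-- The conditional law of the channel input given the secret message. -/
def inputGivenSecret (c : SecrecyCode X Y n R₀ R₁) (m₁ : Message n R₁) : PMF (Fin n → X) :=
  (PMF.uniformOfFintype (Message n R₀)).bind fun m₀ => c.encoder (m₀, m₁)

lemma inputGivenSecret_bind {β : Type*} (c : SecrecyCode X Y n R₀ R₁) (m₁ : Message n R₁)
    (f : (Fin n → X) → PMF β) (b : β) :
    (c.inputGivenSecret m₁).bind f b =
      (Fintype.card (Message n R₀) : ℝ≥0∞)⁻¹ * ∑ m₀, (c.encoder (m₀, m₁)).bind f b := by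
  rw [inputGivenSecret, PMF.bind_bind, bind_apply_eq_sum, Finset.mul_sum]
  simp only [PMF.uniformOfFintype_apply]

/-- Both sides of the secrecy constraint carry the factor `1 / |M₁|`; cancelling it leaves a
condition on the input law averaged over `M₀`. -/
lemma isPerfect_iff (c : SecrecyCode X Y n R₀ R₁) (W : X → PMF (Y × Z)) (PZ : PMF Z) :
    c.IsPerfect W PZ ↔ ∀ m₁, (c.inputGivenSecret m₁).bind (memoryless (eavesdropperChannel W)) =
      productPMF fun _ => PZ := by
  have h0 : (Fintype.card (Message n R₁) : ℝ≥0∞) ≠ 0 := by exact_mod_cast Fintype.card_ne_zero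
  have ht : (Fintype.card (Message n R₁) : ℝ≥0∞) ≠ ∞ := ENNReal.natCast_ne_top _
  refine forall_congr' fun m₁ => ?_
  rw [← DFunLike.coe_fn_eq, funext_iff]
  refine forall_congr' fun z => ?_
  rw [law_map_secret_eavesdropper, law_map_secret, inputGivenSecret_bind, ← Finset.mul_sum,
    Fintype.card_prod, Nat.cast_mul, ENNReal.mul_inv (.inr ht) (.inl (ENNReal.natCast_ne_top _)),
    mul_comm (Fintype.card (Message n R₀) : ℝ≥0∞)⁻¹, mul_assoc,
    ENNReal.mul_right_inj (ENNReal.inv_ne_zero.2 ht) (ENNReal.inv_ne_top.2 h0)]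
  rfl

/-- Bounding the output probabilities by `1` leaves, for each `y`, the total mass of the decoder.
This crude bound suffices to bound the region. -/
lemma successProb_le (c : SecrecyCode X Y n R₀ R₁) (W : X → PMF (Y × Z)) :
    c.successProb W ≤ (Fintype.card (Message n R₀ × Message n R₁) : ℝ≥0∞)⁻¹ *
      (Fintype.card Y : ℝ≥0∞) ^ n := by
  rw [successProb, ← Finset.mul_sum, Finset.sum_comm]
  gcongr
  calc ∑ y, ∑ m, c.legitimateOutput W m y * c.decoder y m
      ≤ ∑ y, ∑ m, c.decoder y m := by
        gcongr with y _ m _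
        exact mul_le_of_le_one_left' (PMF.coe_le_one _ _)
    _ = (Fintype.card Y : ℝ≥0∞) ^ n := by
        simp [sum_coe_eq_one]

/-- If the legitimate receiver's observation is independent of the secret message, the decoder can
only guess that message. -/
lemma successProb_le_of_forall_eq (c : SecrecyCode X Y n R₀ R₁) (W : X → PMF (Y × Z))
    (P : PMF (Fin n → Y))
    (h : ∀ m₁, (c.inputGivenSecret m₁).bind (memoryless (legitimateChannel W)) = P) :
    c.successProb W ≤ (Fintype.card (Message n R₁) : ℝ≥0∞)⁻¹ := by
  have hP (m₁ : Message n R₁) (y : Fin n → Y) : (Fintype.card (Message n R₀) : ℝ≥0∞)⁻¹ *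
      ∑ m₀, c.legitimateOutput W (m₀, m₁) y = P y := by
    rw [← h m₁, inputGivenSecret_bind]
    rfl
  calc c.successProb W
      = (Fintype.card (Message n R₁) : ℝ≥0∞)⁻¹ * ∑ y, ∑ m₁,
          (Fintype.card (Message n R₀) : ℝ≥0∞)⁻¹ *
            ∑ m₀, c.legitimateOutput W (m₀, m₁) y * c.decoder y (m₀, m₁) := by
        rw [successProb, ← Finset.mul_sum, Finset.sum_comm, Fintype.card_prod, Nat.cast_mul,
          ENNReal.mul_inv (.inr (ENNReal.natCast_ne_top _)) (.inl (ENNReal.natCast_ne_top _)),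
          mul_comm (Fintype.card (Message n R₀) : ℝ≥0∞)⁻¹, mul_assoc]
        congr 1
        rw [Finset.mul_sum]
        refine Finset.sum_congr rfl fun y _ => ?_
        rw [Fintype.sum_prod_type_right, Finset.mul_sum]
    _ ≤ (Fintype.card (Message n R₁) : ℝ≥0∞)⁻¹ * ∑ y, ∑ m₁,
          P y * ∑ m₀, c.decoder y (m₀, m₁) := by
        -- Replacing each decoder term by its sum over `m₀` frees the average over `m₀`, which is `P
        -- y`.
        gcongr _ * ∑ y, ∑ m₁, ?_ with y _ m₁ _
        rw [← hP m₁ y, mul_assoc, Finset.sum_mul]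
        gcongr with m₀ _
        exact Finset.single_le_sum (f := fun m => c.decoder y (m, m₁)) (fun _ _ => zero_le)
          (Finset.mem_univ m₀)
    _ = (Fintype.card (Message n R₁) : ℝ≥0∞)⁻¹ := by
        simp only [← Finset.mul_sum, ← Fintype.sum_prod_type_right, sum_coe_eq_one, mul_one]

end SecrecyCode

/-! ### Input distributions inducing a given output -/

section InputDistributions

variable {A B : Type*} [Fintype A]

/-- Some input distribution inducing `P` has the largest support among all of them. -/
lemma exists_inputsInducing_support_maximal {V : A → PMF B} {P : PMF B}
    (h : (inputsInducing V P).Nonempty) :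
    ∃ Q ∈ inputsInducing V P, ∀ Q' ∈ inputsInducing V P, Q'.support ⊆ Q.support := by
  classical
  obtain ⟨Q₀, hQ₀⟩ := h
  let S : Set A := {a | ∃ Q ∈ inputsInducing V P, Q a ≠ 0}
  choose F hF hF' using fun a : S => a.2
  obtain ⟨a₀, ha₀⟩ := Q₀.support_nonempty
  have : Nonempty S := ⟨⟨a₀, Q₀, hQ₀, ha₀⟩⟩
  -- Mix one witness `F a` for each usable letter `a`; mixing preserves the induced output.
  refine ⟨(PMF.uniformOfFintype S).bind F, ?_, fun Q' hQ' a ha => ?_⟩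
  · have hF'' : ∀ a, (F a).bind V = P := hF
    simp [inputsInducing, hF'']
  · rw [PMF.mem_support_bind_iff]
    exact ⟨⟨a, Q', hQ', ha⟩, PMF.mem_support_uniformOfFintype _, hF' ⟨a, Q', hQ', ha⟩⟩

/-- Letters of positive mass leave room for a small move, and `ν` vanishes on the others. -/
lemma exists_perturbation (Q : PMF A) (ν : A → ℝ) (hν : ∀ a, Q a = 0 → ν a = 0)
    (hsum : ∑ a, ν a = 0) :
    ∃ ε > 0, ∃ Q' : PMF A, ∀ a, (Q' a).toReal = (Q a).toReal + ε * ν a := by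
  have h1 : ∀ᶠ ε : ℝ in 𝓝[>] 0, ∀ a, 0 ≤ (Q a).toReal + ε * ν a := by
    rw [Filter.eventually_all]
    intro a
    by_cases ha : Q a = 0
    · simp [ha, hν a ha]
    · have hpos : 0 < (Q a).toReal := ENNReal.toReal_pos ha (Q.apply_ne_top a)
      have hc : Filter.Tendsto (fun ε : ℝ => (Q a).toReal + ε * ν a) (𝓝[>] 0)
          (𝓝 ((Q a).toReal + 0 * ν a)) :=
        Continuous.continuousWithinAt (by fun_prop)
      rw [zero_mul, add_zero] at hc
      exact (hc.eventually (lt_mem_nhds hpos)).mono fun _ => le_of_lt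
  obtain ⟨ε, hε, hpos⟩ := (h1.and self_mem_nhdsWithin).exists
  refine ⟨ε, hpos, PMF.ofFintype (fun a => ENNReal.ofReal ((Q a).toReal + ε * ν a)) ?_,
    fun a => ENNReal.toReal_ofReal (hε a)⟩
  rw [← ENNReal.ofReal_sum_of_nonneg fun a _ => hε a, Finset.sum_add_distrib,
    sum_toReal_eq_one, ← Finset.mul_sum, hsum, mul_zero, add_zero, ENNReal.ofReal_one]

lemma toReal_bind_apply_of_perturbation {Q Q' : PMF A} {ν : A → ℝ} {ε : ℝ}
    (h : ∀ a, (Q' a).toReal = (Q a).toReal + ε * ν a) (V : A → PMF B) (b : B) :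
    (Q'.bind V b).toReal = (Q.bind V b).toReal + ε * ∑ a, ν a * (V a b).toReal := by
  simp only [toReal_bind_apply, h, add_mul, Finset.sum_add_distrib, Finset.mul_sum, mul_assoc]

end InputDistributions

/-! ### Channels that are not redundant -/

/-- Moving `Q` slightly along `ν` keeps `PZ`; a change in the law of `Y` would witness redundancy.
-/
lemma sum_mul_legitimate_eq_zero {W : X → PMF (Y × Z)} {PZ : PMF Z} (hW : ¬ IsRedundant W PZ)
    {Q : PMF X} (hQ : Q ∈ inputsInducing (eavesdropperChannel W) PZ) (ν : X → ℝ)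
    (hν : ∀ x, Q x = 0 → ν x = 0)
    (hZ : ∀ z, ∑ x, ν x * (eavesdropperChannel W x z).toReal = 0) (y : Y) :
    ∑ x, ν x * (legitimateChannel W x y).toReal = 0 := by
  have hsum : ∑ x, ν x = 0 := by
    calc ∑ x, ν x = ∑ x, ∑ z, ν x * (eavesdropperChannel W x z).toReal := by
          simp only [← Finset.mul_sum, sum_toReal_eq_one, mul_one]
      _ = 0 := by
          rw [Finset.sum_comm]
          exact Finset.sum_eq_zero fun z _ => hZ z
  obtain ⟨ε, hε, Q', hQ'⟩ := exists_perturbation Q ν hν hsum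
  have hmem : Q' ∈ inputsInducing (eavesdropperChannel W) PZ := by
    refine Eq.trans (pmf_ext_toReal fun z => ?_) hQ
    rw [toReal_bind_apply_of_perturbation hQ', hZ, mul_zero, add_zero]
  by_contra hy
  refine hW ⟨Q, hQ, Q', hmem, fun h => ?_⟩
  have h' := toReal_bind_apply_of_perturbation hQ' (legitimateChannel W) y
  rw [← h, left_eq_add, mul_eq_zero] at h'
  exact h'.elim hε.ne' hy

/-- If the channel is not redundant then, on the inputs that can be used without changing `PZ`, the
legitimate receiver's channel factors linearly through the eavesdropper's. -/
lemma exists_linear_degradation {W : X → PMF (Y × Z)} {PZ : PMF Z} (hW : ¬ IsRedundant W PZ)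
    (hPZ : (inputsInducing (eavesdropperChannel W) PZ).Nonempty) :
    ∃ G : Y → Z → ℝ, ∀ Q ∈ inputsInducing (eavesdropperChannel W) PZ, ∀ x ∈ Q.support, ∀ y,
      (legitimateChannel W x y).toReal = ∑ z, (eavesdropperChannel W x z).toReal * G y z := by
  classical
  obtain ⟨Q, hQ, hmax⟩ := exists_inputsInducing_support_maximal hPZ
  -- The common kernel of these functionals consists of the `ν` that vanish off the support of `Q`
  -- and are invisible to the eavesdropper.
  let L : Z ⊕ X → (X → ℝ) →ₗ[ℝ] ℝ := Sum.elim
    (fun z => Fintype.linearCombination ℝ fun x => (eavesdropperChannel W x z).toReal)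
    (fun x => if Q x = 0 then LinearMap.proj x else 0)
  have hspan (y : Y) : (Fintype.linearCombination ℝ fun x => (legitimateChannel W x y).toReal) ∈
      Submodule.span ℝ (Set.range L) := by
    refine mem_span_of_iInf_ker_le_ker fun ν hν => ?_
    rw [Submodule.mem_iInf] at hν
    have h1 : ∀ x, Q x = 0 → ν x = 0 := fun x hx => by
      have := hν (.inr x)
      simpa [L, hx] using this
    have h2 : ∀ z, ∑ x, ν x * (eavesdropperChannel W x z).toReal = 0 := fun z => by
      have := hν (.inl z)
      simpa [L, Fintype.linearCombination_apply] using this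
    simpa [Fintype.linearCombination_apply] using sum_mul_legitimate_eq_zero hW hQ ν h1 h2 y
  simp only [Submodule.mem_span_range_iff_exists_fun] at hspan
  choose c hc using hspan
  refine ⟨fun y z => c y (.inl z), fun Q' hQ' x hx y => ?_⟩
  have hx' : Q x ≠ 0 := hmax Q' hQ' hx
  -- At the point mass at `x` the coordinate functionals vanish, since `x` lies in the support of
  -- `Q`; only the coefficients indexed by `Z` remain.
  have key := LinearMap.congr_fun (hc y) (Pi.single x 1)
  have hzero : ∀ x', c y (.inr x') * (L (.inr x')) (Pi.single x 1) = 0 := fun x' => by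
    by_cases h : x' = x
    · subst h; simp [L, hx']
    · by_cases h0 : Q x' = 0 <;> simp [L, h0, h]
  simp only [Fintype.sum_sum_type, LinearMap.add_apply, LinearMap.sum_apply,
    LinearMap.smul_apply, smul_eq_mul, hzero, Finset.sum_const_zero, add_zero] at key
  simp only [L, Sum.elim_inl, Fintype.linearCombination_apply_single, one_smul] at key
  rw [← key]
  exact Finset.sum_congr rfl fun z _ => mul_comm _ _

/-- If the channel is not redundant, the law of the eavesdropper's observation determines the law of
the legitimate receiver's. -/
lemma exists_legitimate_law_of_not_isRedundant {W : X → PMF (Y × Z)} {PZ : PMF Z}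
    (hW : ¬ IsRedundant W PZ) (hPZ : (inputsInducing (eavesdropperChannel W) PZ).Nonempty)
    (n : ℕ) :
    ∃ P : PMF (Fin n → Y), ∀ Q : PMF (Fin n → X),
      Q.bind (memoryless (eavesdropperChannel W)) = (productPMF fun _ => PZ) →
        Q.bind (memoryless (legitimateChannel W)) = P := by
  classical
  obtain ⟨G, hG⟩ := exists_linear_degradation hW hPZ
  have key : ∀ Q : PMF (Fin n → X),
      Q.bind (memoryless (eavesdropperChannel W)) = (productPMF fun _ => PZ) → ∀ y,
        (Q.bind (memoryless (legitimateChannel W)) y).toReal =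
          ∑ z : Fin n → Z, (productPMF (fun _ => PZ) z).toReal * ∏ i, G (y i) (z i) := by
    intro Q hQ y
    -- Each letter marginal of the input induces `PZ`, so the linear relation applies to every
    -- letter used.
    have hmarg (i : Fin n) : Q.map (fun x => x i) ∈ inputsInducing (eavesdropperChannel W) PZ := by
      have h := congrArg (PMF.map fun z => z i) hQ
      rw [productPMF_map_eval, PMF.map_bind] at h
      rw [inputsInducing, Set.mem_ofPred_eq, PMF.bind_map, ← h]
      exact congrArg _ (funext fun x => (productPMF_map_eval (fun i => eavesdropperChannel W (x i)) i).symm)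
    simp only [← hQ, toReal_bind_apply, Finset.sum_mul]
    rw [Finset.sum_comm]
    refine Finset.sum_congr rfl fun x _ => ?_
    by_cases hx : Q x = 0
    · simp [hx]
    simp only [memoryless_apply, ENNReal.toReal_prod, mul_assoc, ← Finset.mul_sum,
      ← Finset.prod_mul_distrib]
    rw [← Fintype.prod_sum fun i z => (eavesdropperChannel W (x i) z).toReal * G (y i) z]
    congr 1
    refine Finset.prod_congr rfl fun i _ => hG _ (hmarg i) _ ?_ _
    rw [PMF.mem_support_map_iff]
    exact ⟨x, hx, rfl⟩
  obtain ⟨Q₀, hQ₀⟩ := hPZ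
  have hQ₀' : (productPMF fun _ : Fin n => Q₀).bind (memoryless (eavesdropperChannel W)) =
      productPMF fun _ => PZ := by
    rw [productPMF_bind_memoryless, show Q₀.bind (eavesdropperChannel W) = PZ from hQ₀]
  exact ⟨_, fun Q hQ => pmf_ext_toReal fun y => (key Q hQ y).trans (key _ hQ₀' y).symm⟩

/-! ### Bhattacharyya coefficients and random coding -/

section Bhattacharyya

variable {B : Type*} [Fintype B]

/-- The Bhattacharyya coefficient of two distributions. -/
def bhattacharyya (p q : PMF B) : ℝ := ∑ b, √((p b).toReal * (q b).toReal)

lemma bhattacharyya_nonneg (p q : PMF B) : 0 ≤ bhattacharyya p q :=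
  Finset.sum_nonneg fun _ _ => Real.sqrt_nonneg _

lemma bhattacharyya_self (p : PMF B) : bhattacharyya p p = 1 := by
  simp [bhattacharyya, sum_toReal_eq_one]

lemma bhattacharyya_comm (p q : PMF B) : bhattacharyya p q = bhattacharyya q p := by
  simp [bhattacharyya, mul_comm]

/-- Termwise AM-GM, strict wherever `p` and `q` differ. -/
lemma bhattacharyya_lt_one {p q : PMF B} (h : p ≠ q) : bhattacharyya p q < 1 := by
  have key (x y : ℝ) (hx : 0 ≤ x) (hy : 0 ≤ y) : (x + y) / 2 - √(x * y) = (√x - √y) ^ 2 / 2 := by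
    rw [Real.sqrt_mul hx, sub_sq, Real.sq_sqrt hx, Real.sq_sqrt hy]
    ring
  have hsum : ∑ b, ((p b).toReal + (q b).toReal) / 2 = 1 := by
    rw [← Finset.sum_div, Finset.sum_add_distrib, sum_toReal_eq_one, sum_toReal_eq_one]
    norm_num
  rw [bhattacharyya, ← hsum]
  obtain ⟨b, hb⟩ : ∃ b, (p b).toReal ≠ (q b).toReal := by
    by_contra! h'
    exact h (pmf_ext_toReal h')
  refine Finset.sum_lt_sum (fun b _ => ?_) ⟨b, Finset.mem_univ b, ?_⟩
  · rw [← sub_nonneg, key _ _ ENNReal.toReal_nonneg ENNReal.toReal_nonneg]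
    positivity
  · rw [← sub_pos, key _ _ ENNReal.toReal_nonneg ENNReal.toReal_nonneg]
    have : √(p b).toReal - √(q b).toReal ≠ 0 := by
      rwa [sub_ne_zero, Ne, Real.sqrt_inj ENNReal.toReal_nonneg ENNReal.toReal_nonneg]
    positivity

lemma bhattacharyya_productPMF (p q : Fin n → PMF B) :
    bhattacharyya (productPMF p) (productPMF q) = ∏ i, bhattacharyya (p i) (q i) := by
  simp only [bhattacharyya, Fintype.prod_sum, productPMF_apply, ENNReal.toReal_prod,
    ← Finset.prod_mul_distrib]
  refine Finset.sum_congr rfl fun b _ => ?_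
  exact Real.sqrt_prod _ fun i _ => by positivity

/-- For uniform `v` the coefficient factorizes over positions, each contributing `1` or `β` with
equal weight. The constant sum on the right makes this a comparison of averages. -/
lemma sum_bhattacharyya_productPMF (p : Bool → PMF B) (u : Fin n → Bool) :
    ∑ v : Fin n → Bool, bhattacharyya (productPMF fun i => p (v i)) (productPMF fun i => p (u i)) =
      ∑ _v : Fin n → Bool, ((1 + bhattacharyya (p true) (p false)) / 2) ^ n := by
  simp only [bhattacharyya_productPMF]
  rw [← Fintype.prod_sum fun i b => bhattacharyya (p b) (p (u i))]
  have h (b : Bool) : ∑ a, bhattacharyya (p a) (p b) = 1 + bhattacharyya (p true) (p false) := by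
    cases b
    · rw [Fintype.sum_bool, bhattacharyya_self, add_comm]
    · rw [Fintype.sum_bool, bhattacharyya_self, bhattacharyya_comm]
  rw [Finset.prod_congr rfl fun i _ => h (u i)]
  simp [div_pow, mul_div_cancel₀]

/-- Maximum likelihood decoding makes the total error at most the sum of the pairwise Bhattacharyya
coefficients. -/
lemma exists_decoder {ι : Type*} [Fintype ι] [DecidableEq ι] [Nonempty ι] (K : ι → PMF B) :
    ∃ D : B → ι, ∑ i, ∑ b, (K i b).toReal * (if D b = i then 0 else 1) ≤
      ∑ i, ∑ j, if i = j then 0 else bhattacharyya (K j) (K i) := by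
  choose D hD using fun b => Finite.exists_max fun i => (K i b).toReal
  refine ⟨D, Finset.sum_le_sum fun i _ => ?_⟩
  have h (j : ι) : (if i = j then 0 else bhattacharyya (K j) (K i)) =
      ∑ b, if i = j then 0 else √((K j b).toReal * (K i b).toReal) := by
    split_ifs <;> simp [bhattacharyya]
  simp only [h]
  rw [Finset.sum_comm]
  refine Finset.sum_le_sum fun b _ => ?_
  have hnonneg (j : ι) : 0 ≤ if i = j then 0 else √((K j b).toReal * (K i b).toReal) := by
    split_ifs <;> positivity
  by_cases hi : D b = i
  · rw [if_pos hi, mul_zero]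
    exact Finset.sum_nonneg fun j _ => hnonneg j
  · rw [if_neg hi, mul_one]
    -- The term `j = D b` suffices: its likelihood is at least that of `i`, so the square root is
    -- too.
    refine le_trans ?_ (Finset.single_le_sum (fun j _ => hnonneg j) (Finset.mem_univ (D b)))
    rw [if_neg (Ne.symm hi)]
    refine Real.le_sqrt_of_sq_le ?_
    rw [sq]
    exact mul_le_mul_of_nonneg_right (hD b i) ENNReal.toReal_nonneg

/-- Random coding: some codebook does at least as well as the average codebook. -/
lemma exists_codebook {ι A : Type*} [Fintype ι] [DecidableEq ι] [Fintype A] [Nonempty A]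
    (f : A → A → ℝ) {δ : ℝ} (hδ : 0 ≤ δ) (hf : ∀ a, ∑ a', f a' a ≤ ∑ _a' : A, δ) :
    ∃ C : ι → A, ∑ i, ∑ j, (if i = j then 0 else f (C j) (C i)) ≤
      (Fintype.card ι : ℝ) ^ 2 * δ := by
  have h (i j : ι) : ∑ C : ι → A, (if i = j then 0 else f (C j) (C i)) ≤ ∑ _C : ι → A, δ := by
    by_cases hij : i = j
    · simp only [if_pos hij]
      exact Finset.sum_le_sum fun _ _ => hδ
    · simp only [if_neg hij]
      -- Isolate the codeword `C j`; with the others fixed, including `C i`, the inner sum is the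
      -- one in `hf`.
      rw [← (Equiv.funSplitAt j A).symm.sum_comp, ← (Equiv.funSplitAt j A).symm.sum_comp,
        Fintype.sum_prod_type_right, Fintype.sum_prod_type_right]
      refine Finset.sum_le_sum fun C _ => ?_
      simpa [Equiv.funSplitAt, Equiv.piSplitAt, hij] using hf (C ⟨i, hij⟩)
  obtain ⟨C, -, hC⟩ := Finset.exists_le_of_sum_le
    (f := fun C : ι → A => ∑ i, ∑ j, (if i = j then 0 else f (C j) (C i)))
    (g := fun _ => (Fintype.card ι : ℝ) ^ 2 * δ) (s := Finset.univ) Finset.univ_nonempty (by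
      calc ∑ C : ι → A, ∑ i, ∑ j, (if i = j then 0 else f (C j) (C i))
          = ∑ i, ∑ j, ∑ C : ι → A, (if i = j then 0 else f (C j) (C i)) := by
            rw [Finset.sum_comm]
            exact Finset.sum_congr rfl fun i _ => Finset.sum_comm
        _ ≤ ∑ _i : ι, ∑ _j : ι, ∑ _C : ι → A, δ := by
            exact Finset.sum_le_sum fun i _ => Finset.sum_le_sum fun j _ => h i j
        _ = ∑ _C : ι → A, (Fintype.card ι : ℝ) ^ 2 * δ := by
            simp
            ring)
  exact ⟨C, hC⟩

/-- A channel with two distinct rows has codes of every size whose error is controlled by an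
exponentially decreasing factor. -/
lemma exists_binary_code (p : Bool → PMF B) (n : ℕ) (ι : Type*) [Fintype ι] [DecidableEq ι]
    [Nonempty ι] :
    ∃ (C : ι → Fin n → Bool) (D : (Fin n → B) → ι),
      ∑ i, ∑ b, (productPMF (fun k => p (C i k)) b).toReal * (if D b = i then 0 else 1) ≤
        (Fintype.card ι : ℝ) ^ 2 * ((1 + bhattacharyya (p true) (p false)) / 2) ^ n := by
  have h0 := bhattacharyya_nonneg (p true) (p false)
  obtain ⟨C, hC⟩ := exists_codebook (ι := ι)
    (fun v u : Fin n → Bool =>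
      bhattacharyya (productPMF fun i => p (v i)) (productPMF fun i => p (u i)))
    (δ := ((1 + bhattacharyya (p true) (p false)) / 2) ^ n) (by positivity)
    fun u => (sum_bhattacharyya_productPMF p u).le
  obtain ⟨D, hD⟩ := exists_decoder fun i => productPMF fun k => p (C i k)
  exact ⟨C, D, hD.trans hC⟩

end Bhattacharyya

/-- Encoding each bit of a binary codeword by one of two input distributions that induce `PZ`. -/
lemma exists_secrecyCode {W : X → PMF (Y × Z)} {PZ : PMF Z} (F : Bool → PMF X)
    (hF : ∀ b, F b ∈ inputsInducing (eavesdropperChannel W) PZ) (n : ℕ) (R₀ R₁ : ℝ≥0) :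
    ∃ c : SecrecyCode X Y n R₀ R₁, c.IsPerfect W PZ ∧
      c.errorProb W ≤ ENNReal.ofReal (Fintype.card (Message n R₀ × Message n R₁) *
        ((1 + bhattacharyya ((F true).bind (legitimateChannel W))
          ((F false).bind (legitimateChannel W))) / 2) ^ n) := by
  classical
  obtain ⟨C, D, hCD⟩ := exists_binary_code (fun b => (F b).bind (legitimateChannel W)) n
    (Message n R₀ × Message n R₁)
  let c : SecrecyCode X Y n R₀ R₁ := ⟨fun m => productPMF fun i => F (C m i), fun y => .pure (D y)⟩
  have hF' (b : Bool) : (F b).bind (eavesdropperChannel W) = PZ := hF b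
  refine ⟨c, ?_, ?_⟩
  · rw [SecrecyCode.isPerfect_iff]
    intro m₁
    simp [SecrecyCode.inputGivenSecret, c, PMF.bind_bind, productPMF_bind_memoryless, hF']
  · have hterm (m) : c.legitimateOutput W m =
        productPMF fun i => (F (C m i)).bind (legitimateChannel W) :=
      productPMF_bind_memoryless _ _
    have hreal : c.errorProb W = ENNReal.ofReal
        ((Fintype.card (Message n R₀ × Message n R₁) : ℝ)⁻¹ * ∑ m, ∑ y,
          (c.legitimateOutput W m y).toReal * (if D y = m then 0 else 1)) := by
      have hcard : (0 : ℝ) < Fintype.card (Message n R₀ × Message n R₁) := by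
        exact_mod_cast Fintype.card_pos
      rw [SecrecyCode.errorProb_eq, ← Finset.mul_sum, ENNReal.ofReal_mul (by positivity),
        ENNReal.ofReal_inv_of_pos hcard, ENNReal.ofReal_natCast]
      congr 1
      have h0 (m y) : 0 ≤ (c.legitimateOutput W m y).toReal * (if D y = m then (0 : ℝ) else 1) := by
        positivity
      rw [ENNReal.ofReal_sum_of_nonneg fun m _ => Finset.sum_nonneg fun y _ => h0 m y]
      refine Finset.sum_congr rfl fun m _ => ?_
      rw [ENNReal.ofReal_sum_of_nonneg fun y _ => h0 m y]
      refine Finset.sum_congr rfl fun y _ => ?_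
      rw [ENNReal.ofReal_mul ENNReal.toReal_nonneg, ENNReal.ofReal_toReal (PMF.apply_ne_top _ _)]
      congr 1
      rw [PMF.toOuterMeasure_pure_apply]
      by_cases h : D y = m
      · simp [h]
      · simp [h, Ne.symm h]
    rw [hreal]
    refine ENNReal.ofReal_le_ofReal ?_
    simp only [hterm]
    refine (mul_le_mul_of_nonneg_left hCD (by positivity)).trans_eq ?_
    have hcard : (Fintype.card (Message n R₀ × Message n R₁) : ℝ) ≠ 0 := by
      exact_mod_cast Fintype.card_ne_zero
    rw [sq, mul_assoc, inv_mul_cancel_left₀ hcard]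

/-! ### Achievable rates -/

/-- The factor `2` absorbs the floor: `⌊t⌋ ≥ t / 2` for `t ≥ 1`. -/
lemma card_message_inv_le (n : ℕ) (R : ℝ≥0) :
    (Fintype.card (Message n R) : ℝ≥0∞)⁻¹ ≤ ENNReal.ofReal (2 * Real.exp (-R) ^ n) := by
  have h1 : (1 : ℝ) ≤ Real.exp (n * R) := Real.one_le_exp (by positivity)
  have h2 : 1 ≤ ⌊Real.exp (n * R)⌋₊ := Nat.floor_pos.2 h1
  have h3 := Nat.lt_floor_add_one (Real.exp (n * R))
  have h4 : (1 : ℝ) ≤ ⌊Real.exp (n * R)⌋₊ := by exact_mod_cast h2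
  rw [Fintype.card_fin, ← ENNReal.ofReal_natCast, ← ENNReal.ofReal_inv_of_pos (by linarith)]
  refine ENNReal.ofReal_le_ofReal ?_
  rw [← Real.exp_nat_mul, mul_neg, Real.exp_neg, ← div_eq_mul_inv, inv_le_comm₀ (by linarith)
    (by positivity), inv_div]
  linarith

lemma card_message_le (n : ℕ) (R : ℝ≥0) : (Fintype.card (Message n R) : ℝ) ≤ Real.exp R ^ n := by
  rw [Fintype.card_fin, ← Real.exp_nat_mul]
  exact Nat.floor_le (Real.exp_nonneg _)

lemma tendsto_ofReal_two_mul_pow {a : ℝ} (h0 : 0 ≤ a) (h1 : a < 1) :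
    Filter.Tendsto (fun n : ℕ => ENNReal.ofReal (2 * a ^ n)) Filter.atTop (𝓝 0) := by
  have h := (tendsto_pow_atTop_nhds_zero_of_lt_one h0 h1).const_mul 2
  simpa using ENNReal.tendsto_ofReal h

/-- If the success probability vanishes, the error probability does not. -/
lemma not_tendsto_errorProb {W : X → PMF (Y × Z)} (c : ∀ n : ℕ, SecrecyCode X Y n R₀ R₁) {a : ℝ}
    (h0 : 0 ≤ a) (h1 : a < 1) (h : ∀ n, (c n).successProb W ≤ ENNReal.ofReal (2 * a ^ n)) :
    ¬ Filter.Tendsto (fun n => (c n).errorProb W) Filter.atTop (𝓝 0) := by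
  intro he
  have hs := tendsto_of_tendsto_of_tendsto_of_le_of_le tendsto_const_nhds
    (tendsto_ofReal_two_mul_pow h0 h1) (fun _ => zero_le) h
  have h2 := he.add hs
  simp only [SecrecyCode.errorProb_add_successProb, add_zero] at h2
  exact one_ne_zero (tendsto_nhds_unique tendsto_const_nhds h2)

lemma not_isAchievable_of_log_card_lt {W : X → PMF (Y × Z)} {PZ : PMF Z} {R : ℝ≥0}
    (hR : Real.log (Fintype.card Y) < R) (hle : ∀ n : ℕ,
      Fintype.card (Message n R) ≤ Fintype.card (Message n R₀ × Message n R₁)) :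
    ¬ IsAchievable W PZ (R₀, R₁) := by
  rintro ⟨c, hc, -⟩
  refine not_tendsto_errorProb c (a := Real.exp (-R) * Fintype.card Y) (by positivity) ?_
    (fun n => ?_) hc
  · rw [Real.exp_neg, inv_mul_lt_iff₀ (Real.exp_pos _), mul_one]
    -- An empty `Y` is separate because `Real.log 0 = 0` is a default value.
    rcases Nat.eq_zero_or_pos (Fintype.card Y) with h | h
    · rw [h, Nat.cast_zero]
      exact Real.exp_pos _
    · exact (Real.log_lt_iff_lt_exp (by exact_mod_cast h)).1 hR
  · calc (c n).successProb W
        ≤ (Fintype.card (Message n R₀ × Message n R₁) : ℝ≥0∞)⁻¹ * (Fintype.card Y : ℝ≥0∞) ^ n :=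
          (c n).successProb_le W
      _ ≤ ENNReal.ofReal (2 * Real.exp (-R) ^ n) * (Fintype.card Y : ℝ≥0∞) ^ n := by
          gcongr
          refine le_trans (ENNReal.inv_le_inv.2 ?_) (card_message_inv_le n R)
          exact_mod_cast hle n
      _ = ENNReal.ofReal (2 * (Real.exp (-R) * Fintype.card Y) ^ n) := by
          rw [mul_pow, ← mul_assoc,
            ENNReal.ofReal_mul (p := 2 * Real.exp (-R) ^ n) (by positivity),
            ENNReal.ofReal_pow (p := (Fintype.card Y : ℝ)) (by positivity),
            ENNReal.ofReal_natCast]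

lemma IsAchievable.mem_Icc {W : X → PMF (Y × Z)} {PZ : PMF Z} {R : ℝ≥0 × ℝ≥0}
    (h : IsAchievable W PZ R) :
    R ∈ Set.Icc 0 ((Real.log (Fintype.card Y)).toNNReal, (Real.log (Fintype.card Y)).toNNReal) := by
  have key (R' : ℝ≥0) (hle : ∀ n : ℕ,
      Fintype.card (Message n R') ≤ Fintype.card (Message n R.1 × Message n R.2)) :
      R' ≤ (Real.log (Fintype.card Y)).toNNReal := by
    by_contra! hlt
    exact not_isAchievable_of_log_card_lt ((Real.le_coe_toNNReal _).trans_lt (NNReal.coe_lt_coe.2 hlt)) hle h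
  refine ⟨zero_le, key R.1 fun n => ?_, key R.2 fun n => ?_⟩ <;> rw [Fintype.card_prod]
  · exact Nat.le_mul_of_pos_right _ Fintype.card_pos
  · exact Nat.le_mul_of_pos_left _ Fintype.card_pos

lemma IsAchievable.snd_eq_zero {W : X → PMF (Y × Z)} {PZ : PMF Z} {R : ℝ≥0 × ℝ≥0}
    (h : IsAchievable W PZ R) (hW : ¬ IsRedundant W PZ)
    (hPZ : (inputsInducing (eavesdropperChannel W) PZ).Nonempty) : R.2 = 0 := by
  by_contra hR
  have hpos : (0 : ℝ) < R.2 := by exact_mod_cast pos_iff_ne_zero.2 hR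
  obtain ⟨c, hc, hperf⟩ := h
  refine not_tendsto_errorProb c (Real.exp_nonneg (-R.2)) ?_ (fun n => ?_) hc
  · rw [Real.exp_lt_one_iff]
    linarith
  · obtain ⟨P, hP⟩ := exists_legitimate_law_of_not_isRedundant hW hPZ n
    have hperf' := ((c n).isPerfect_iff W PZ).1 (hperf n)
    exact ((c n).successProb_le_of_forall_eq W P fun m₁ => hP _ (hperf' m₁)).trans
      (card_message_inv_le n R.2)

lemma isAchievable_of_exp_mul_lt_one {W : X → PMF (Y × Z)} {PZ : PMF Z} (F : Bool → PMF X)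
    (hF : ∀ b, F b ∈ inputsInducing (eavesdropperChannel W) PZ) {R : ℝ≥0}
    (hR : Real.exp R * ((1 + bhattacharyya ((F true).bind (legitimateChannel W))
      ((F false).bind (legitimateChannel W))) / 2) < 1) :
    IsAchievable W PZ (0, R) := by
  choose c hperf herr using fun n => exists_secrecyCode F hF n 0 R
  refine ⟨c, ?_, hperf⟩
  have h0 := bhattacharyya_nonneg ((F true).bind (legitimateChannel W))
    ((F false).bind (legitimateChannel W))
  refine tendsto_of_tendsto_of_tendsto_of_le_of_le tendsto_const_nhds
    (tendsto_ofReal_two_mul_pow (by positivity) hR) (fun _ => zero_le) fun n => ?_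
  refine (herr n).trans (ENNReal.ofReal_le_ofReal ?_)
  rw [mul_pow, ← mul_assoc]
  refine mul_le_mul_of_nonneg_right ?_ (by positivity)
  have h1 : Fintype.card (Message n 0) = 1 := by simp
  rw [Fintype.card_prod, h1, one_mul]
  have h2 := card_message_le n R
  have h3 : 0 < Real.exp R ^ n := by positivity
  linarith

/-- The rate condition holds strictly at `R = 0` because `β < 1`, hence for small `R > 0` by
continuity. -/
lemma exists_pos_isAchievable {W : X → PMF (Y × Z)} {PZ : PMF Z} (hW : IsRedundant W PZ) :
    ∃ R : ℝ≥0, 0 < R ∧ IsAchievable W PZ (0, R) := by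
  obtain ⟨Q, hQ, Q', hQ', hne⟩ := hW
  have h0 := bhattacharyya_nonneg (Q.bind (legitimateChannel W)) (Q'.bind (legitimateChannel W))
  have h1 := bhattacharyya_lt_one hne
  set β := bhattacharyya (Q.bind (legitimateChannel W)) (Q'.bind (legitimateChannel W))
  have hlim : Filter.Tendsto (fun R : ℝ≥0 => Real.exp R * ((1 + β) / 2)) (𝓝[>] 0)
      (𝓝 (Real.exp (0 : ℝ≥0) * ((1 + β) / 2))) :=
    Continuous.continuousWithinAt (by fun_prop)
  have hlt : Real.exp (0 : ℝ≥0) * ((1 + β) / 2) < 1 := by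
    rw [NNReal.coe_zero, Real.exp_zero]
    linarith
  obtain ⟨R, hR, hpos⟩ := ((hlim.eventually (gt_mem_nhds hlt)).and self_mem_nhdsWithin).exists
  refine ⟨R, hpos, isAchievable_of_exp_mul_lt_one (fun b => if b then Q else Q') ?_ ?_⟩
  · intro b
    cases b <;> simp [hQ, hQ']
  · simpa using hR

/-- At zero rates there is a single message pair, so no error can occur. -/
lemma isAchievable_zero {W : X → PMF (Y × Z)} {PZ : PMF Z}
    (hPZ : (inputsInducing (eavesdropperChannel W) PZ).Nonempty) : IsAchievable W PZ 0 := by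
  obtain ⟨Q, hQ⟩ := hPZ
  choose c hperf _ using fun n => exists_secrecyCode (fun _ => Q) (fun _ => hQ) n 0 0
  refine ⟨c, ?_, hperf⟩
  have herr (n : ℕ) : (c n).errorProb W = 0 := by
    have hsub : Subsingleton (Message n 0) := by
      rw [← Fintype.card_le_one_iff_subsingleton]
      simp
    have hempty (m : Message n 0 × Message n 0) : {m' | m ≠ m'} = ∅ :=
      Set.eq_empty_of_forall_notMem fun m' h => h (Subsingleton.elim m m')
    rw [SecrecyCode.errorProb_eq]
    simp [hempty]
  simp only [Prod.fst_zero, Prod.snd_zero, herr, tendsto_const_nhds]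

end Wiretap

end

/-- The first conjunct says that the maximum that defines the capacity exists. -/
theorem mainTheorem12 {X Y Z : Type*} [Fintype X] [Fintype Y] [Fintype Z]
    (W : X → PMF (Y × Z)) (PZ : PMF Z)
    (hPZ : (Wiretap.inputsInducing (Wiretap.eavesdropperChannel W) PZ).Nonempty) :
    IsGreatest (Wiretap.admissibleSecrecyRates W PZ) (Wiretap.stealthSecrecyCapacity W PZ) ∧
      (0 < Wiretap.stealthSecrecyCapacity W PZ ↔ Wiretap.IsRedundant W PZ) := by
  have hsub := closure_minimal
    (fun R (hR : Wiretap.IsAchievable W PZ R) => hR.mem_Icc) isClosed_Icc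
  have hcompact : IsCompact (Wiretap.admissibleSecrecyRates W PZ) :=
    (isCompact_Icc.of_isClosed_subset isClosed_closure hsub).image continuous_snd
  have hgreatest : IsGreatest (Wiretap.admissibleSecrecyRates W PZ)
      (Wiretap.stealthSecrecyCapacity W PZ) :=
    hcompact.isGreatest_sSup ⟨0, 0, subset_closure (Wiretap.isAchievable_zero hPZ), rfl⟩
  refine ⟨hgreatest, fun hpos => ?_, fun hW => ?_⟩
  · by_contra hW
    -- `R₁ = 0` is a closed condition, so it passes from achievable pairs to their closure.
    have hzero : Wiretap.admissibleRegion W PZ ⊆ Prod.snd ⁻¹' {0} :=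
      closure_minimal (fun R (hR : Wiretap.IsAchievable W PZ R) => hR.snd_eq_zero hW hPZ)
        (isClosed_singleton.preimage continuous_snd)
    obtain ⟨R, hR, hRC⟩ := hgreatest.1
    exact hpos.ne' (hRC.symm.trans (hzero hR))
  · obtain ⟨R, hpos, hR⟩ := Wiretap.exists_pos_isAchievable hW
    exact hpos.trans_le (hgreatest.2 ⟨(0, R), subset_closure hR, rfl⟩)
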